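/- Let $\mathcal H$ be a separable complex Hilbert space. Let $V_q$ be the real vector space of self-adjoint trace-class operators on $\mathcal H$, with the cone $V_q^+$ of positive operators, the charge functional $e(z)=\operatorname{Tr} z$ and the trace norm $\|z\|_1=\operatorname{Tr}|z|$. A stochastic map on $V_q$ is a real-linear map $\Phi:V_q\to V_q$ that is positive ($\Phi(V_q^+)\subseteq V_q^+$) and charge-preserving ($e\circ\Phi=e$). For a bounded antilinear operator $U$ on $\mathcal H$, the adjoint $U^*$ is the antilinear operator determined by $\langle U^*y\,|\,x\rangle=\langle Ux\,|\,y\rangle$ for all $x,y\in\mathcal H$. Let $\Phi:V_q\to V_q$ be a surjective stochastic map. Then $\Phi$ is an isometry, i.e. $\|\Phi(z)\|_1=\|z\|_1$ for all $z\in V_q$, if and only if there is a linear or antilinear isometry $U:\mathcal H\to\mathcal H$ such that $\Phi(z)=UzU^*$ for all $z\in V_q$. Moreover, $\Phi$ is an isometry if and only if there is a unitary or antiunitary operator $U$ on $\mathcal H$ such that $\Phi(z)=UzU^*$ for all $z\in V_q$. -/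

import Mathlib

open scoped InnerProductSpace ENNReal

namespace QuantumMC

variable {H : Type*} [NormedAddCommGroup H] [InnerProductSpace ℂ H]

/-- The sum `∑ i, ⟨b i, P (b i)⟩ ∈ [0, ∞]` of the diagonal entries of a positive operator `P`. -/
noncomputable def diagSum {ι : Type*} (b : HilbertBasis ι ℂ H) (P : H →L[ℂ] H) : ℝ≥0∞ :=
  ∑' i, ENNReal.ofReal (⟪b i, P (b i)⟫_ℂ).re

variable [CompleteSpace H]

variable (H) in
/-- Index set of a fixed orthonormal basis of `H`. -/
def basisIndex : Set H := Classical.choose (exists_hilbertBasis ℂ H)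

variable (H) in
/-- A fixed orthonormal basis of `H`, in which traces are computed. The values do not depend on
this choice, see `diagSum_abs_eq` and `hasSum_trace`. -/
noncomputable def basis : HilbertBasis (basisIndex H) ℂ H :=
  Classical.choose (Classical.choose_spec (exists_hilbertBasis ℂ H))

/-- The trace norm `‖T‖₁ = Tr |T| ∈ [0, ∞]`, where `|T| = (T* T)^{1/2}`. -/
noncomputable def eTraceNorm (T : H →L[ℂ] H) : ℝ≥0∞ :=
  diagSum (basis H) (CFC.abs T)

/-- `T` is of trace class: `Tr |T| < ∞`. -/
def IsTraceClass (T : H →L[ℂ] H) : Prop := eTraceNorm T < ∞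

/-! ### Self-adjoint trace-class operators form a real vector space -/

set_option linter.unusedSectionVars false

lemma re_nonneg {P : H →L[ℂ] H} (hP : 0 ≤ P) (x : H) : 0 ≤ (⟪x, P x⟫_ℂ).re :=
  ((ContinuousLinearMap.nonneg_iff_isPositive P).1 hP).re_inner_nonneg_right x

lemma re_mono {P Q : H →L[ℂ] H} (h : P ≤ Q) (x : H) :
    (⟪x, P x⟫_ℂ).re ≤ (⟪x, Q x⟫_ℂ).re := by
  have := re_nonneg (sub_nonneg.2 h) x
  simp only [sub_apply, inner_sub_right, Complex.sub_re] at this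
  linarith

lemma diagSum_mono {ι : Type*} (b : HilbertBasis ι ℂ H) {P Q : H →L[ℂ] H} (h : P ≤ Q) :
    diagSum b P ≤ diagSum b Q :=
  ENNReal.tsum_le_tsum fun i => ENNReal.ofReal_le_ofReal (re_mono h (b i))

lemma diagSum_add {ι : Type*} (b : HilbertBasis ι ℂ H) {P Q : H →L[ℂ] H}
    (hP : 0 ≤ P) (hQ : 0 ≤ Q) : diagSum b (P + Q) = diagSum b P + diagSum b Q := by
  unfold diagSum
  rw [← ENNReal.tsum_add]
  refine tsum_congr fun i => ?_
  rw [← ENNReal.ofReal_add (re_nonneg hP _) (re_nonneg hQ _)]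
  simp

lemma parseval {ι : Type*} (b : HilbertBasis ι ℂ H) (x : H) :
    ENNReal.ofReal (‖x‖ ^ 2) = ∑' i, ENNReal.ofReal (‖⟪b i, x⟫_ℂ‖ ^ 2) := by
  have h := (Complex.hasSum_iff _ _).1 (b.hasSum_inner_mul_inner x x) |>.1
  have e : (fun i => (⟪x, b i⟫_ℂ * ⟪b i, x⟫_ℂ).re) = fun i => ‖⟪b i, x⟫_ℂ‖ ^ 2 := by
    funext i
    rw [← inner_conj_symm x (b i), ← Complex.normSq_eq_conj_mul_self, Complex.ofReal_re,
      Complex.normSq_eq_norm_sq]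
  rw [e] at h
  have h2 : (⟪x, x⟫_ℂ).re = ‖x‖ ^ 2 := by
    rw [inner_self_eq_norm_sq_to_K]; norm_cast
  rw [h2] at h
  rw [← h.tsum_eq, ENNReal.ofReal_tsum_of_nonneg (fun i => by positivity) h.summable]

lemma hs_adjoint {ι κ : Type*} (b : HilbertBasis ι ℂ H) (c : HilbertBasis κ ℂ H)
    (S : H →L[ℂ] H) :
    ∑' i, ENNReal.ofReal (‖S (b i)‖ ^ 2) = ∑' j, ENNReal.ofReal (‖(star S) (c j)‖ ^ 2) := by
  simp_rw [fun i => parseval c (S (b i)), fun j => parseval b ((star S) (c j))]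
  rw [ENNReal.tsum_comm]
  refine tsum_congr fun j => tsum_congr fun i => ?_
  rw [ContinuousLinearMap.star_eq_adjoint, ContinuousLinearMap.adjoint_inner_right,
    ← inner_conj_symm, RCLike.norm_conj]

lemma diagSum_star_mul {ι : Type*} (b : HilbertBasis ι ℂ H) (S : H →L[ℂ] H) :
    diagSum b (star S * S) = ∑' i, ENNReal.ofReal (‖S (b i)‖ ^ 2) := by
  refine tsum_congr fun i => ?_
  congr 1
  rw [mul_apply_eq_comp, ContinuousLinearMap.star_eq_adjoint,
    ContinuousLinearMap.adjoint_inner_right, inner_self_eq_norm_sq_to_K]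
  norm_cast

/-- The trace of a positive operator does not depend on the orthonormal basis. -/
lemma diagSum_eq {ι κ : Type*} (b : HilbertBasis ι ℂ H) (c : HilbertBasis κ ℂ H)
    {P : H →L[ℂ] H} (hP : 0 ≤ P) : diagSum b P = diagSum c P := by
  obtain ⟨S, rfl⟩ := CStarAlgebra.nonneg_iff_eq_star_mul_self.1 hP
  rw [diagSum_star_mul, diagSum_star_mul, hs_adjoint b b, hs_adjoint c b]

/-- The trace norm does not depend on the orthonormal basis. -/
lemma diagSum_abs_eq {ι : Type*} (b : HilbertBasis ι ℂ H) (T : H →L[ℂ] H) :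
    diagSum b (CFC.abs T) = eTraceNorm T :=
  diagSum_eq _ _ (CFC.abs_nonneg T)

lemma diagSum_conj_le {ι : Type*} (b : HilbertBasis ι ℂ H) {P C : H →L[ℂ] H} (hP : 0 ≤ P)
    (hC : ‖C‖ ≤ 1) : diagSum b (star C * P * C) ≤ diagSum b P := by
  obtain ⟨S, rfl⟩ := CStarAlgebra.nonneg_iff_eq_star_mul_self.1 hP
  have e : star C * (star S * S) * C = star (S * C) * (S * C) := by
    rw [star_mul]; simp only [mul_assoc]
  rw [e, diagSum_star_mul, diagSum_star_mul, hs_adjoint b b, hs_adjoint b b S]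
  refine ENNReal.tsum_le_tsum fun i => ENNReal.ofReal_le_ofReal ?_
  rw [star_mul, mul_apply_eq_comp]
  gcongr
  calc ‖(star C) ((star S) (b i))‖ ≤ ‖star C‖ * ‖(star S) (b i)‖ := (star C).le_opNorm _
    _ ≤ 1 * ‖(star S) (b i)‖ := by gcongr; rwa [norm_star]
    _ = _ := one_mul _

lemma exists_cutoff {R : Type*} [CStarAlgebra R] [PartialOrder R] [StarOrderedRing R] {a : R}
    (ha : IsSelfAdjoint a) {ε : ℝ} (hε0 : 0 < ε) :
    ∃ c : R, ‖c‖ ≤ 1 ∧ a⁺ - algebraMap ℝ R ε ≤ star c * a * c := by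
  set f : ℝ → ℝ := fun x => min 1 (max x 0 / ε) with hf
  have hfc : Continuous f := by fun_prop
  have hfc' : ContinuousOn f (spectrum ℝ a) := hfc.continuousOn
  have hfx : ContinuousOn (fun x => f x * x) (spectrum ℝ a) := by fun_prop
  have hs : star (cfc f a) = cfc f a := IsSelfAdjoint.cfc
  refine ⟨cfc f a, norm_cfc_le zero_le_one fun x _ => ?_, ?_⟩
  · have : 0 ≤ f x := le_min zero_le_one (by positivity)
    rw [Real.norm_of_nonneg this]
    exact min_le_left _ _
  have e1 : a⁺ = cfc (fun x : ℝ => max x 0) a := by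
    rw [CFC.posPart_def, cfcₙ_eq_cfc]; rfl
  have e2 : star (cfc f a) * a * cfc f a = cfc (fun x : ℝ => f x * x * f x) a := by
    rw [hs, cfc_mul (fun x => f x * x) f a hfx hfc', cfc_mul f (fun x => x) a hfc' (by fun_prop),
      cfc_id' ℝ a]
  rw [e1, e2, ← cfc_const ε a, ← cfc_sub (fun x : ℝ => max x 0) (fun _ => ε) a]
  refine cfc_mono (fun x _ => ?_) (by fun_prop) (hfx.mul hfc')
  have key : max x 0 - ε ≤ f x * x * f x := by
    simp only [hf]
    rcases le_total x 0 with hx | hx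
    · simp [max_eq_right hx, hε0.le]
    · rw [max_eq_left hx]
      rcases le_total ε x with h | h
      · rw [min_eq_left ((one_le_div hε0).2 h)]; linarith
      · have : 0 ≤ min 1 (x / ε) := le_min zero_le_one (by positivity)
        nlinarith [mul_nonneg (mul_nonneg this hx) this]
  exact key

lemma diagSum_posPart_le {ι : Type*} (b : HilbertBasis ι ℂ H) {A P : H →L[ℂ] H}
    (hA : IsSelfAdjoint A) (hP : 0 ≤ P) (hAP : A ≤ P) : diagSum b A⁺ ≤ diagSum b P := by
  unfold diagSum
  rw [ENNReal.tsum_eq_iSup_sum]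
  refine iSup_le fun F => ENNReal.le_of_forall_pos_le_add fun δ hδ _ => ?_
  set ε : ℝ := δ / (F.card + 1) with hε
  have hε0 : 0 < ε := by positivity
  obtain ⟨C, hCn, h1⟩ := exists_cutoff hA hε0
  replace h1 := h1.trans (star_left_conjugate_le_conjugate hAP C)
  have h2 : ∀ i, ENNReal.ofReal (⟪b i, A⁺ (b i)⟫_ℂ).re ≤
      ENNReal.ofReal (⟪b i, (star C * P * C) (b i)⟫_ℂ).re + ENNReal.ofReal ε := by
    intro i
    rw [← ENNReal.ofReal_add (re_nonneg (star_left_conjugate_nonneg hP C) _) hε0.le]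
    refine ENNReal.ofReal_le_ofReal ?_
    have := re_mono h1 (b i)
    have e3 : (algebraMap ℝ (H →L[ℂ] H) ε) (b i) = (ε : ℂ) • b i := by
      rw [Algebra.algebraMap_eq_smul_one]; simp
    rw [sub_apply, inner_sub_right, e3, inner_smul_right,
      inner_self_eq_norm_sq_to_K, b.orthonormal.1 i] at this
    simp at this
    exact this
  calc ∑ i ∈ F, ENNReal.ofReal (⟪b i, A⁺ (b i)⟫_ℂ).re
      ≤ ∑ i ∈ F, (ENNReal.ofReal (⟪b i, (star C * P * C) (b i)⟫_ℂ).re + ENNReal.ofReal ε) :=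
        Finset.sum_le_sum fun i _ => h2 i
    _ = ∑ i ∈ F, ENNReal.ofReal (⟪b i, (star C * P * C) (b i)⟫_ℂ).re
          + F.card * ENNReal.ofReal ε := by
        rw [Finset.sum_add_distrib, Finset.sum_const, nsmul_eq_mul]
    _ ≤ diagSum b P + δ := by
        refine add_le_add ((ENNReal.sum_le_tsum F).trans (diagSum_conj_le b hP hCn)) ?_
        rw [← ENNReal.ofReal_natCast, ← ENNReal.ofReal_mul (by positivity),
          ← ENNReal.ofReal_coe_nnreal]
        refine ENNReal.ofReal_le_ofReal ?_
        rw [hε, mul_div_assoc', div_le_iff₀ (by positivity)]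
        nlinarith [δ.coe_nonneg]

lemma diagSum_posPart_le_abs {ι : Type*} (b : HilbertBasis ι ℂ H) {A : H →L[ℂ] H}
    (hA : IsSelfAdjoint A) :
    diagSum b A⁺ ≤ diagSum b (CFC.abs A) ∧ diagSum b A⁻ ≤ diagSum b (CFC.abs A) := by
  rw [← CFC.posPart_add_negPart A hA]
  exact ⟨diagSum_mono b (le_add_of_nonneg_right (CFC.negPart_nonneg A)),
    diagSum_mono b (le_add_of_nonneg_left (CFC.posPart_nonneg A))⟩

/-- `‖P - Q‖₁ ≤ Tr P + Tr Q` for positive operators `P`, `Q`. -/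
lemma eTraceNorm_sub_le {P Q : H →L[ℂ] H} (hP : 0 ≤ P) (hQ : 0 ≤ Q) :
    eTraceNorm (P - Q) ≤ diagSum (basis H) P + diagSum (basis H) Q := by
  have hA : IsSelfAdjoint (P - Q) := (IsSelfAdjoint.of_nonneg hP).sub (IsSelfAdjoint.of_nonneg hQ)
  have h1 : P - Q ≤ P := sub_le_self _ hQ
  have h2 : -(P - Q) ≤ Q := by rw [neg_sub]; exact sub_le_self _ hP
  have h3 := diagSum_posPart_le (basis H) hA hP h1
  have h4 := diagSum_posPart_le (basis H) hA.neg hQ h2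
  rw [CFC.posPart_neg] at h4
  have h5 := diagSum_add (basis H) (CFC.posPart_nonneg (P - Q)) (CFC.negPart_nonneg (P - Q))
  rw [CFC.posPart_add_negPart _ hA] at h5
  exact h5.trans_le (add_le_add h3 h4)

/-- The triangle inequality for the trace norm of self-adjoint operators. -/
lemma eTraceNorm_add_le {S T : H →L[ℂ] H} (hS : IsSelfAdjoint S) (hT : IsSelfAdjoint T) :
    eTraceNorm (S + T) ≤ eTraceNorm S + eTraceNorm T := by
  have e : S + T = (S⁺ + T⁺) - (S⁻ + T⁻) := by
    nth_rewrite 1 [← CFC.posPart_sub_negPart S hS]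
    nth_rewrite 1 [← CFC.posPart_sub_negPart T hT]
    abel
  rw [e]
  refine (eTraceNorm_sub_le (add_nonneg (CFC.posPart_nonneg S) (CFC.posPart_nonneg T))
    (add_nonneg (CFC.negPart_nonneg S) (CFC.negPart_nonneg T))).trans (le_of_eq ?_)
  unfold eTraceNorm
  rw [← CFC.posPart_add_negPart S hS, ← CFC.posPart_add_negPart T hT,
    diagSum_add _ (CFC.posPart_nonneg S) (CFC.posPart_nonneg T),
    diagSum_add _ (CFC.negPart_nonneg S) (CFC.negPart_nonneg T),
    diagSum_add _ (CFC.posPart_nonneg S) (CFC.negPart_nonneg S),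
    diagSum_add _ (CFC.posPart_nonneg T) (CFC.negPart_nonneg T)]
  abel

lemma eTraceNorm_smul (r : ℝ) (T : H →L[ℂ] H) :
    eTraceNorm (r • T) = ENNReal.ofReal |r| * eTraceNorm T := by
  unfold eTraceNorm diagSum
  rw [CFC.abs_smul, ← ENNReal.tsum_mul_left]
  refine tsum_congr fun i => ?_
  rw [← ENNReal.ofReal_mul (abs_nonneg r)]
  congr 1
  rw [smul_apply, inner_smul_right_eq_smul]
  simp

variable (H) in
/-- The real vector space `V_q` of self-adjoint trace-class operators on `H`. -/
def TraceClassSA : Submodule ℝ (H →L[ℂ] H) where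
  carrier := {T | IsSelfAdjoint T ∧ IsTraceClass T}
  zero_mem' := ⟨.zero _, by
    have h := eTraceNorm_smul (0 : ℝ) (0 : H →L[ℂ] H)
    simp at h
    simp [IsTraceClass, h]⟩
  add_mem' := fun hS hT => ⟨hS.1.add hT.1,
    (eTraceNorm_add_le hS.1 hT.1).trans_lt (ENNReal.add_lt_top.2 ⟨hS.2, hT.2⟩)⟩
  smul_mem' := fun r T hT => ⟨(IsSelfAdjoint.all r).smul hT.1, by
    unfold IsTraceClass
    rw [eTraceNorm_smul]
    exact ENNReal.mul_lt_top ENNReal.ofReal_lt_top hT.2⟩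

/-- The trace norm (the 1-norm) on `V_q`. -/
noncomputable def traceNorm (z : TraceClassSA H) : ℝ := (eTraceNorm (z : H →L[ℂ] H)).toReal

/-! ### The trace -/

/-- The trace `Tr T = ∑ i, ⟨b i, T (b i)⟩`. -/
noncomputable def trace (T : H →L[ℂ] H) : ℂ := ∑' i, ⟪basis H i, T (basis H i)⟫_ℂ

lemma hasSum_diag {ι : Type*} (b : HilbertBasis ι ℂ H) {P : H →L[ℂ] H} (hP : 0 ≤ P)
    (h : diagSum (basis H) P < ∞) :
    HasSum (fun i => ⟪b i, P (b i)⟫_ℂ) ((diagSum (basis H) P).toReal : ℂ) := by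
  have e : (fun i => ⟪b i, P (b i)⟫_ℂ) = fun i => (((⟪b i, P (b i)⟫_ℂ).re : ℝ) : ℂ) := by
    funext i
    have := ((ContinuousLinearMap.nonneg_iff_isPositive P).1 hP).inner_nonneg_right (b i)
    exact (Complex.eq_re_of_ofReal_le (r := 0) (by simpa using this))
  rw [e, diagSum_eq _ b hP]
  rw [diagSum_eq _ b hP] at h
  refine Complex.hasSum_ofReal.2 ?_
  have hs := ENNReal.summable_toReal h.ne
  have := hs.hasSum
  rw [← ENNReal.tsum_toReal_eq (fun _ => ENNReal.ofReal_ne_top)] at this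
  simpa only [diagSum, ENNReal.toReal_ofReal (re_nonneg hP _)] using this

lemma hasSum_diag_sub {ι : Type*} (b : HilbertBasis ι ℂ H) (z : TraceClassSA H) :
    HasSum (fun i => ⟪b i, (z : H →L[ℂ] H) (b i)⟫_ℂ)
      ((diagSum (basis H) (z : H →L[ℂ] H)⁺).toReal -
        (diagSum (basis H) (z : H →L[ℂ] H)⁻).toReal : ℂ) := by
  obtain ⟨A, hA, hT⟩ := z
  have hp := (diagSum_posPart_le_abs (basis H) hA).1.trans_lt hT
  have hn := (diagSum_posPart_le_abs (basis H) hA).2.trans_lt hT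
  have := (hasSum_diag b (CFC.posPart_nonneg A) hp).sub (hasSum_diag b (CFC.negPart_nonneg A) hn)
  simp_rw [← inner_sub_right, ← sub_apply, CFC.posPart_sub_negPart A hA] at this
  exact this

/-- The series defining the trace of a self-adjoint trace-class operator converges in every
orthonormal basis, to the same value. -/
lemma hasSum_trace {ι : Type*} (b : HilbertBasis ι ℂ H) (z : TraceClassSA H) :
    HasSum (fun i => ⟪b i, (z : H →L[ℂ] H) (b i)⟫_ℂ) (trace (z : H →L[ℂ] H)) := by
  have h := hasSum_diag_sub b z
  rw [← (hasSum_diag_sub (basis H) z).tsum_eq] at h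
  exact h

variable (H) in
/-- The charge functional on `V_q`: the (real) trace. -/
noncomputable def charge : TraceClassSA H →ₗ[ℝ] ℝ where
  toFun z := (trace (z : H →L[ℂ] H)).re
  map_add' x y := by
    have h := (hasSum_trace (basis H) x).add (hasSum_trace (basis H) y)
    have h' := hasSum_trace (basis H) (x + y)
    simp only [Submodule.coe_add, add_apply, inner_add_right] at h'
    rw [Submodule.coe_add, h'.unique h, Complex.add_re]
  map_smul' r x := by
    have h := (hasSum_trace (basis H) x).const_smul r
    have h' := hasSum_trace (basis H) (r • x)
    simp only [Submodule.coe_smul, smul_apply, inner_smul_right_eq_smul] at h'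
    rw [Submodule.coe_smul, h'.unique h]
    simp

/-- A stochastic map on `V_q`: a real-linear map that is positive and charge-preserving. -/
structure IsStochastic (Φ : TraceClassSA H →ₗ[ℝ] TraceClassSA H) : Prop where
  positive : ∀ z : TraceClassSA H, 0 ≤ (z : H →L[ℂ] H) → 0 ≤ (Φ z : H →L[ℂ] H)
  charge_preserving : ∀ z : TraceClassSA H, charge H (Φ z) = charge H z

/-- `Φ` preserves the trace norm. -/
def IsTraceNormIsometry (Φ : TraceClassSA H →ₗ[ℝ] TraceClassSA H) : Prop :=
  ∀ z : TraceClassSA H, traceNorm (Φ z) = traceNorm z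

/-! ### Maps induced by (anti)linear operators -/

/-- The adjoint `U*` of a bounded antilinear operator `U`: the vector `U* y` is the unique one with
`⟨U* y, x⟩ = ⟨U x, y⟩` for all `x` (see `inner_antiAdjoint`). -/
noncomputable def antiAdjoint (U : H →L⋆[ℂ] H) (y : H) : H :=
  (InnerProductSpace.toDual ℂ H).symm ((innerSLFlip ℂ y).comp U)

lemma inner_antiAdjoint (U : H →L⋆[ℂ] H) (x y : H) :
    ⟪antiAdjoint U y, x⟫_ℂ = ⟪U x, y⟫_ℂ := by
  simp [antiAdjoint]

/-- `Φ z = U z U*` for all `z`, with `U` linear. -/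
def InducedByLinear (Φ : TraceClassSA H →ₗ[ℝ] TraceClassSA H) (U : H →L[ℂ] H) : Prop :=
  ∀ (z : TraceClassSA H) (x : H),
    (Φ z : H →L[ℂ] H) x = U ((z : H →L[ℂ] H) (ContinuousLinearMap.adjoint U x))

/-- `Φ z = U z U*` for all `z`, with `U` antilinear. -/
def InducedByAntilinear (Φ : TraceClassSA H →ₗ[ℝ] TraceClassSA H) (U : H →L⋆[ℂ] H) : Prop :=
  ∀ (z : TraceClassSA H) (x : H),
    (Φ z : H →L[ℂ] H) x = U ((z : H →L[ℂ] H) (antiAdjoint U x))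

end QuantumMC

/-!
A surjective stochastic map `Φ` preserves the trace norm if and only if it reflects positivity
(`IsStochastic.reflectsPositivity`, `IsStochastic.isTraceNormIsometry`): an element `z` of `V_q` is
positive exactly when `‖z‖₁ = Tr z`, and conversely the Jordan decompositions of `z` and of `Φ z`
can be transported along `Φ` and `Φ⁻¹`, which gives the two inequalities between the norms. So an
isometric `Φ` is a trace-preserving order automorphism of `V_q`, and a Wigner-type theorem for such
maps remains to be shown.

Order automorphisms preserve the extreme rays of the positive cone, which are spanned by the
operators `|x⟩⟨x|` (`IsStochastic.exists_map_ray_eq`). Fix a unit vector `e` with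
`Φ |e⟩⟨e| = |e'⟩⟨e'|`. Real-linearity of `Φ` takes the place of transition probabilities: for
`y ⟂ e` the operators `Φ |e + t y⟩⟨e + t y|`, `t` real, have rank one and depend quadratically on
`t`, so they are `|e' + t u⟩⟨e' + t u|` for a fixed `u` (`IsStochastic.exists_map_cross_eq`).
Preservation of the trace and injectivity force `u ⟂ e'`, hence `u = Φ (|e⟩⟨y| + |y⟩⟨e|) e'` is a
real-linear isometric function of `y` (`IsStochastic.crossMap_spec`). It carries multiplication by
`I` to multiplication by `I` or `-I`, with one sign for all `y` by additivity. Extending it to `e`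
accordingly yields a linear or antilinear isometry `W` with `Φ |x⟩⟨x| = |W x⟩⟨W x|`
(`IsStochastic.exists_isometry_map_ray`).

A positive `z = S* S` is the sum of the operators `|S* bᵢ⟩⟨S* bᵢ|` over an orthonormal basis, with
positive remainders of vanishing trace, so `Φ z = W z W*` (`IsStochastic.map_apply_eq`).
Conversely `z ↦ W z W*` reflects positivity because `W* W = 1`
(`reflectsPositivity_of_induced`), and if it is surjective then `W` is
surjective, hence unitary or antiunitary (`surjective_of_induced`).
-/

namespace QuantumMC

variable {H : Type*} [NormedAddCommGroup H] [InnerProductSpace ℂ H] [CompleteSpace H]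

/-! ### Positive operators and their trace -/

lemma nonneg_of_re_inner_nonneg {A : H →L[ℂ] H} (hA : IsSelfAdjoint A)
    (h : ∀ x, 0 ≤ (⟪x, A x⟫_ℂ).re) : 0 ≤ A := by
  rw [ContinuousLinearMap.nonneg_iff_isPositive, ContinuousLinearMap.isPositive_def']
  refine ⟨hA, fun x => ?_⟩
  rw [ContinuousLinearMap.reApplyInnerSelf_apply, ← inner_conj_symm, RCLike.conj_re]
  exact h x

lemma apply_eq_zero_of_re_inner_eq_zero {A : H →L[ℂ] H} (hA : 0 ≤ A) {x : H}
    (h : (⟪x, A x⟫_ℂ).re = 0) : A x = 0 := by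
  obtain ⟨S, rfl⟩ := CStarAlgebra.nonneg_iff_eq_star_mul_self.1 hA
  rw [mul_apply_eq_comp, ContinuousLinearMap.star_eq_adjoint,
    ContinuousLinearMap.adjoint_inner_right, inner_self_eq_norm_sq_to_K] at h
  have h2 : ‖S x‖ ^ 2 = 0 := by exact_mod_cast h
  have h3 : S x = 0 := by simpa using h2
  rw [mul_apply_eq_comp, h3, map_zero]

/-- A quadratic form `⟪x, P x⟫` of a positive operator is bounded by `Tr P`. -/
lemma ofReal_re_inner_le_diagSum {ι : Type*} (b : HilbertBasis ι ℂ H) {P : H →L[ℂ] H}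
    (hP : 0 ≤ P) (x : H) :
    ENNReal.ofReal (⟪x, P x⟫_ℂ).re ≤ diagSum b P * ENNReal.ofReal (‖x‖ ^ 2) := by
  obtain ⟨S, rfl⟩ := CStarAlgebra.nonneg_iff_eq_star_mul_self.1 hP
  have e : (⟪x, (star S * S) x⟫_ℂ).re = ‖S x‖ ^ 2 := by
    rw [mul_apply_eq_comp, ContinuousLinearMap.star_eq_adjoint,
      ContinuousLinearMap.adjoint_inner_right, inner_self_eq_norm_sq_to_K]
    norm_cast
  rw [e, diagSum_star_mul, hs_adjoint b b, parseval b, ← ENNReal.tsum_mul_right]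
  refine ENNReal.tsum_le_tsum fun i => ?_
  rw [← ENNReal.ofReal_mul (by positivity), ← mul_pow, ContinuousLinearMap.star_eq_adjoint,
    ← ContinuousLinearMap.adjoint_inner_left]
  exact ENNReal.ofReal_le_ofReal (by gcongr; exact norm_inner_le_norm _ _)

lemma traceNorm_eq_toReal_diagSum {z : TraceClassSA H} (hz : 0 ≤ (z : H →L[ℂ] H)) :
    traceNorm z = (diagSum (basis H) (z : H →L[ℂ] H)).toReal := by
  rw [traceNorm, eTraceNorm, CFC.abs_of_nonneg _ hz]

lemma diagSum_ne_top {z : TraceClassSA H} (hz : 0 ≤ (z : H →L[ℂ] H)) :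
    diagSum (basis H) (z : H →L[ℂ] H) ≠ ∞ := by
  have := z.2.2.ne
  rwa [eTraceNorm, CFC.abs_of_nonneg _ hz] at this

lemma charge_eq_traceNorm {z : TraceClassSA H} (hz : 0 ≤ (z : H →L[ℂ] H)) :
    charge H z = traceNorm z := by
  have h := (hasSum_trace (basis H) z).unique
    (hasSum_diag (basis H) hz (diagSum_ne_top hz).lt_top)
  rw [traceNorm_eq_toReal_diagSum hz]
  change (trace (z : H →L[ℂ] H)).re = _
  rw [h, Complex.ofReal_re]

lemma charge_nonneg {z : TraceClassSA H} (hz : 0 ≤ (z : H →L[ℂ] H)) : 0 ≤ charge H z := by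
  rw [charge_eq_traceNorm hz]
  exact ENNReal.toReal_nonneg

lemma re_inner_le_charge {z : TraceClassSA H} (hz : 0 ≤ (z : H →L[ℂ] H)) (x : H) :
    (⟪x, (z : H →L[ℂ] H) x⟫_ℂ).re ≤ charge H z * ‖x‖ ^ 2 := by
  have h := ENNReal.toReal_mono
    (ENNReal.mul_ne_top (diagSum_ne_top hz) ENNReal.ofReal_ne_top)
    (ofReal_re_inner_le_diagSum (basis H) hz x)
  rwa [ENNReal.toReal_ofReal (re_nonneg hz x), ENNReal.toReal_mul,
    ENNReal.toReal_ofReal (by positivity), ← traceNorm_eq_toReal_diagSum hz,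
    ← charge_eq_traceNorm hz] at h

lemma eq_zero_of_charge_eq_zero {z : TraceClassSA H} (hz : 0 ≤ (z : H →L[ℂ] H))
    (h : charge H z = 0) : z = 0 := by
  ext x
  refine apply_eq_zero_of_re_inner_eq_zero hz (le_antisymm ?_ (re_nonneg hz x))
  simpa [h] using re_inner_le_charge hz x

/-! ### The Jordan decomposition in `V_q` -/

/-- The positive part of `z`, as an element of `V_q`. -/
noncomputable def posPart (z : TraceClassSA H) : TraceClassSA H :=
  ⟨(z : H →L[ℂ] H)⁺, (CFC.posPart_nonneg _).isSelfAdjoint, by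
    rw [IsTraceClass, eTraceNorm, CFC.abs_of_nonneg _ (CFC.posPart_nonneg _)]
    exact (diagSum_posPart_le_abs (basis H) z.2.1).1.trans_lt z.2.2⟩

/-- The negative part of `z`, as an element of `V_q`. -/
noncomputable def negPart (z : TraceClassSA H) : TraceClassSA H :=
  ⟨(z : H →L[ℂ] H)⁻, (CFC.negPart_nonneg _).isSelfAdjoint, by
    rw [IsTraceClass, eTraceNorm, CFC.abs_of_nonneg _ (CFC.negPart_nonneg _)]
    exact (diagSum_posPart_le_abs (basis H) z.2.1).2.trans_lt z.2.2⟩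

lemma posPart_nonneg (z : TraceClassSA H) : 0 ≤ (posPart z : H →L[ℂ] H) := CFC.posPart_nonneg _

lemma negPart_nonneg (z : TraceClassSA H) : 0 ≤ (negPart z : H →L[ℂ] H) := CFC.negPart_nonneg _

lemma posPart_sub_negPart (z : TraceClassSA H) : posPart z - negPart z = z :=
  Subtype.ext (CFC.posPart_sub_negPart _ z.2.1)

lemma traceNorm_sub_le {a b : TraceClassSA H} (ha : 0 ≤ (a : H →L[ℂ] H))
    (hb : 0 ≤ (b : H →L[ℂ] H)) : traceNorm (a - b) ≤ charge H a + charge H b := by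
  rw [charge_eq_traceNorm ha, charge_eq_traceNorm hb, traceNorm_eq_toReal_diagSum ha,
    traceNorm_eq_toReal_diagSum hb, ← ENNReal.toReal_add (diagSum_ne_top ha) (diagSum_ne_top hb)]
  exact ENNReal.toReal_mono (ENNReal.add_ne_top.2 ⟨diagSum_ne_top ha, diagSum_ne_top hb⟩)
    (eTraceNorm_sub_le ha hb)

lemma traceNorm_eq_charge_add (z : TraceClassSA H) :
    traceNorm z = charge H (posPart z) + charge H (negPart z) := by
  rw [charge_eq_traceNorm (posPart_nonneg z), charge_eq_traceNorm (negPart_nonneg z),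
    traceNorm_eq_toReal_diagSum (posPart_nonneg z), traceNorm_eq_toReal_diagSum (negPart_nonneg z),
    ← ENNReal.toReal_add (diagSum_ne_top (posPart_nonneg z)) (diagSum_ne_top (negPart_nonneg z)),
    ← diagSum_add _ (posPart_nonneg z) (negPart_nonneg z), traceNorm, eTraceNorm,
    ← CFC.posPart_add_negPart _ z.2.1]
  rfl

lemma nonneg_of_traceNorm_le_charge {z : TraceClassSA H} (h : traceNorm z ≤ charge H z) :
    0 ≤ (z : H →L[ℂ] H) := by
  have h1 := traceNorm_eq_charge_add z
  have h2 : charge H z = charge H (posPart z) - charge H (negPart z) := by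
    rw [← map_sub, posPart_sub_negPart]
  have h3 : negPart z = 0 := eq_zero_of_charge_eq_zero (negPart_nonneg z)
    (le_antisymm (by linarith) (charge_nonneg (negPart_nonneg z)))
  have h4 := posPart_sub_negPart z
  rw [h3, sub_zero] at h4
  rw [← h4]
  exact posPart_nonneg z

/-! ### Isometric surjective stochastic maps are those that reflect positivity -/

section Reflect

variable {Φ : TraceClassSA H →ₗ[ℝ] TraceClassSA H}

variable (Φ) in
/-- `Φ` reflects positivity: `Φ z ≥ 0` only if `z ≥ 0`. -/
def ReflectsPositivity : Prop :=
  ∀ z : TraceClassSA H, 0 ≤ (Φ z : H →L[ℂ] H) → 0 ≤ (z : H →L[ℂ] H)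

lemma IsStochastic.reflectsPositivity (hΦ : IsStochastic Φ) (h : IsTraceNormIsometry Φ) :
    ReflectsPositivity Φ := fun z hz =>
  nonneg_of_traceNorm_le_charge <| by
    rw [← h z, ← hΦ.charge_preserving z, charge_eq_traceNorm hz]

lemma ReflectsPositivity.injective (h : ReflectsPositivity Φ) : Function.Injective Φ := by
  rw [injective_iff_map_eq_zero]
  intro z hz
  have h1 := h z (by simp [hz])
  have h2 := h (-z) (by simp [hz])
  exact Subtype.ext (le_antisymm (by simpa using h2) h1)

lemma IsStochastic.isTraceNormIsometry (hΦ : IsStochastic Φ) (hs : Function.Surjective Φ)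
    (h : ReflectsPositivity Φ) : IsTraceNormIsometry Φ := by
  intro z
  apply le_antisymm
  · have := traceNorm_sub_le (hΦ.positive _ (posPart_nonneg z)) (hΦ.positive _ (negPart_nonneg z))
    rwa [← map_sub, posPart_sub_negPart, hΦ.charge_preserving, hΦ.charge_preserving,
      ← traceNorm_eq_charge_add] at this
  · -- pull the Jordan decomposition of `Φ z` back to a decomposition of `z`
    obtain ⟨a, ha⟩ := hs (posPart (Φ z))
    obtain ⟨b, hb⟩ := hs (negPart (Φ z))
    have hz : a - b = z := h.injective (by rw [map_sub, ha, hb, posPart_sub_negPart])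
    have := traceNorm_sub_le (h a (ha ▸ posPart_nonneg _)) (h b (hb ▸ negPart_nonneg _))
    rwa [hz, ← hΦ.charge_preserving a, ← hΦ.charge_preserving b, ha, hb,
      ← traceNorm_eq_charge_add] at this

end Reflect

/-! ### Rank-one operators -/

lemma diagSum_rankOne {ι : Type*} (b : HilbertBasis ι ℂ H) (x : H) :
    diagSum b (InnerProductSpace.rankOne ℂ x x) = ENNReal.ofReal (‖x‖ ^ 2) := by
  rw [parseval b x]
  refine tsum_congr fun i => ?_
  rw [InnerProductSpace.rankOne_apply, inner_smul_right, ← inner_conj_symm x (b i),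
    Complex.conj_mul', ← Complex.ofReal_pow, Complex.ofReal_re]

/-- The rank-one operator `|x⟩⟨x|`, as an element of `V_q`. -/
noncomputable def ray (x : H) : TraceClassSA H :=
  ⟨InnerProductSpace.rankOne ℂ x x, (InnerProductSpace.isPositive_rankOne_self x).isSelfAdjoint, by
    rw [IsTraceClass, eTraceNorm, CFC.abs_of_nonneg _
      ((ContinuousLinearMap.nonneg_iff_isPositive _).2
        (InnerProductSpace.isPositive_rankOne_self x)), diagSum_rankOne]
    exact ENNReal.ofReal_lt_top⟩

lemma ray_apply (x y : H) : (ray x : H →L[ℂ] H) y = ⟪x, y⟫_ℂ • x := rfl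

lemma ray_nonneg (x : H) : 0 ≤ (ray x : H →L[ℂ] H) :=
  (ContinuousLinearMap.nonneg_iff_isPositive _).2 (InnerProductSpace.isPositive_rankOne_self x)

lemma inner_ray_apply (x y : H) : ⟪y, (ray x : H →L[ℂ] H) y⟫_ℂ = ((‖⟪x, y⟫_ℂ‖ ^ 2 : ℝ) : ℂ) := by
  rw [ray_apply, inner_smul_right, ← inner_conj_symm y x, Complex.mul_conj']
  norm_cast

lemma charge_ray (x : H) : charge H (ray x) = ‖x‖ ^ 2 := by
  rw [charge_eq_traceNorm (ray_nonneg x), traceNorm_eq_toReal_diagSum (ray_nonneg x)]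
  have : diagSum (basis H) (ray x : H →L[ℂ] H) = ENNReal.ofReal (‖x‖ ^ 2) := diagSum_rankOne _ x
  rw [this, ENNReal.toReal_ofReal (by positivity)]

lemma ray_smul (c : ℂ) (x : H) : ray (c • x) = (‖c‖ ^ 2) • ray x := by
  ext y
  simp only [ray_apply, Submodule.coe_smul, smul_apply, inner_smul_left, smul_smul]
  rw [mul_right_comm, Complex.conj_mul', ← smul_smul, ← Complex.coe_smul]
  norm_cast

lemma ray_zero : ray (0 : H) = 0 := by ext; simp [ray_apply]

lemma norm_eq_of_ray_eq {x y : H} (h : ray x = ray y) : ‖x‖ = ‖y‖ := by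
  have := congrArg (charge H) h
  rw [charge_ray, charge_ray] at this
  exact (pow_left_inj₀ (norm_nonneg _) (norm_nonneg _) two_ne_zero).1 this

/-- Vectors with the same rank-one operator differ by a phase. -/
lemma exists_phase_of_ray_eq {x y : H} (h : ray x = ray y) : ∃ k : ℂ, ‖k‖ = 1 ∧ y = k • x := by
  by_cases hx : x = 0
  · refine ⟨1, by simp, ?_⟩
    have := norm_eq_of_ray_eq h
    rw [hx, norm_zero] at this
    rw [hx, smul_zero, norm_eq_zero.1 this.symm]
  · have hn := norm_eq_of_ray_eq h
    have hy : y ≠ 0 := by rw [← norm_ne_zero_iff, ← hn]; exact norm_ne_zero_iff.2 hx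
    have h1 : ⟪x, y⟫_ℂ • x = ⟪y, y⟫_ℂ • y := by
      rw [← ray_apply, h, ray_apply]
    have hyy : ⟪y, y⟫_ℂ ≠ 0 := inner_self_ne_zero.2 hy
    have h2 : y = (⟪x, y⟫_ℂ / ⟪y, y⟫_ℂ) • x := by
      rw [div_eq_inv_mul, mul_smul, h1, smul_smul, inv_mul_cancel₀ hyy, one_smul]
    refine ⟨_, ?_, h2⟩
    have h3 := congrArg norm h2
    rw [norm_smul, hn] at h3
    exact (mul_right_cancel₀ (norm_ne_zero_iff.2 hy) (by rw [one_mul]; exact h3)).symm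

/-- The operator `|x⟩⟨y| + |y⟩⟨x|`, as an element of `V_q` that is real-linear in `y`. -/
noncomputable def cross (x : H) : H →ₗ[ℝ] TraceClassSA H where
  toFun y := ⟨InnerProductSpace.rankOne ℂ x y + InnerProductSpace.rankOne ℂ y x, by
    have : InnerProductSpace.rankOne ℂ x y + InnerProductSpace.rankOne ℂ y x =
        ((ray (x + y) - ray x - ray y : TraceClassSA H) : H →L[ℂ] H) := by
      ext z
      simp [ray_apply, add_smul]
      abel
    rw [this]
    exact Subtype.coe_prop _⟩
  map_add' y z := by
    ext w
    simp
    abel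
  map_smul' r y := by
    ext w
    have h : ⟪r • y, w⟫_ℂ = (r : ℂ) * ⟪y, w⟫_ℂ := by
      rw [← Complex.coe_smul, inner_smul_left, Complex.conj_ofReal]
    simp [h, mul_smul, smul_comm r]

lemma cross_apply (x y z : H) : (cross x y : H →L[ℂ] H) z = ⟪y, z⟫_ℂ • x + ⟪x, z⟫_ℂ • y := rfl

lemma ray_add (x y : H) : ray (x + y) = ray x + cross x y + ray y := by
  ext z
  simp [ray_apply, cross_apply, add_smul]
  abel

lemma cross_smul_left (c : ℂ) (x y : H) : cross (c • x) y = cross x ((starRingEnd ℂ c) • y) := by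
  ext z
  simp [cross_apply, smul_smul, mul_comm]

lemma charge_cross (x y : H) : charge H (cross x y) = 2 * (⟪x, y⟫_ℂ).re := by
  have h := congrArg (charge H) (ray_add x y)
  rw [map_add, map_add, charge_ray, charge_ray, charge_ray,
    norm_add_sq (𝕜 := ℂ)] at h
  simp only [RCLike.re_to_complex] at h
  linarith

/-! ### Rank-one operators span the extreme rays of the positive cone -/

lemma exists_smul_ray_of_le {B : TraceClassSA H} {x : H} (hB : 0 ≤ (B : H →L[ℂ] H))
    (h : (B : H →L[ℂ] H) ≤ (ray x : H →L[ℂ] H)) : ∃ t : ℝ, B = t • ray x := by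
  by_cases hx : x = 0
  · refine ⟨0, ?_⟩
    rw [hx, ray_zero] at h
    rw [zero_smul]
    exact Subtype.ext (le_antisymm h hB)
  have hxx : ⟪x, x⟫_ℂ ≠ 0 := inner_self_ne_zero.2 hx
  have hsym := ((ContinuousLinearMap.nonneg_iff_isPositive _).1 hB).isSymmetric
  -- `B` vanishes on the orthogonal complement of `x`
  have hker : ∀ y, ⟪x, y⟫_ℂ = 0 → (B : H →L[ℂ] H) y = 0 := by
    intro y hy
    refine apply_eq_zero_of_re_inner_eq_zero hB (le_antisymm ?_ (re_nonneg hB y))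
    refine (re_mono h y).trans ?_
    rw [inner_ray_apply, hy]
    simp
  have hspan : ∀ y, ⟪x, x⟫_ℂ • (B : H →L[ℂ] H) y = ⟪x, y⟫_ℂ • (B : H →L[ℂ] H) x := by
    intro y
    have := hker (⟪x, x⟫_ℂ • y - ⟪x, y⟫_ℂ • x) (by
      rw [inner_sub_right, inner_smul_right, inner_smul_right]; ring)
    rwa [map_sub, map_smul, map_smul, sub_eq_zero] at this
  have hBx : ⟪x, x⟫_ℂ • (B : H →L[ℂ] H) x = ⟪x, (B : H →L[ℂ] H) x⟫_ℂ • x := by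
    refine ext_inner_right ℂ fun y => ?_
    have h1 := congrArg (fun w => ⟪x, w⟫_ℂ) (hspan y)
    simp only [inner_smul_right] at h1
    have h2 : ⟪(B : H →L[ℂ] H) x, y⟫_ℂ = ⟪x, (B : H →L[ℂ] H) y⟫_ℂ := hsym x y
    have h3 : ⟪(B : H →L[ℂ] H) x, x⟫_ℂ = ⟪x, (B : H →L[ℂ] H) x⟫_ℂ := hsym x x
    rw [inner_smul_left, inner_smul_left, inner_conj_symm, inner_conj_symm, h2, h3, h1]
    ring
  have hreal : ⟪x, (B : H →L[ℂ] H) x⟫_ℂ = ((⟪x, (B : H →L[ℂ] H) x⟫_ℂ).re : ℂ) := by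
    have := ((ContinuousLinearMap.nonneg_iff_isPositive _).1 hB).inner_nonneg_right x
    exact Complex.eq_re_of_ofReal_le (r := 0) (by simpa using this)
  refine ⟨(⟪x, (B : H →L[ℂ] H) x⟫_ℂ).re / (‖x‖ ^ 2 * ‖x‖ ^ 2), ?_⟩
  ext y
  have h4 : (⟪x, x⟫_ℂ * ⟪x, x⟫_ℂ) • (B : H →L[ℂ] H) y =
      (⟪x, (B : H →L[ℂ] H) x⟫_ℂ * ⟪x, y⟫_ℂ) • x := by
    rw [mul_smul, hspan, smul_comm, hBx, smul_smul, mul_comm]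
  have h5 : (B : H →L[ℂ] H) y = ((⟪x, x⟫_ℂ * ⟪x, x⟫_ℂ)⁻¹ *
      (⟪x, (B : H →L[ℂ] H) x⟫_ℂ * ⟪x, y⟫_ℂ)) • x := by
    rw [mul_smul, ← h4, smul_smul, inv_mul_cancel₀ (mul_ne_zero hxx hxx), one_smul]
  rw [h5, Submodule.coe_smul, smul_apply, ray_apply, ← Complex.coe_smul, smul_smul, hreal,
    inner_self_eq_norm_sq_to_K]
  congr 1
  push_cast
  simp only [Complex.coe_algebraMap, Complex.ofReal_re, div_eq_mul_inv]
  ring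

/-- A positive operator that dominates only its own multiples has rank at most one: if
`A = S* S`, then `A` dominates `|S* u⟩⟨S* u|` for every unit vector `u`. -/
lemma exists_eq_ray_of_extremal {A : TraceClassSA H} (hA : 0 ≤ (A : H →L[ℂ] H))
    (h : ∀ B : TraceClassSA H, 0 ≤ (B : H →L[ℂ] H) → (B : H →L[ℂ] H) ≤ (A : H →L[ℂ] H) →
      ∃ t : ℝ, B = t • A) : ∃ y, A = ray y := by
  by_cases h0 : A = 0
  · exact ⟨0, by rw [h0, ray_zero]⟩
  obtain ⟨S, hS⟩ := CStarAlgebra.nonneg_iff_eq_star_mul_self.1 hA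
  obtain ⟨v, hv⟩ : ∃ v, (A : H →L[ℂ] H) v ≠ 0 := by
    by_contra! hc
    exact h0 (by ext v; exact hc v)
  have hAS : ∀ x, (A : H →L[ℂ] H) x = ContinuousLinearMap.adjoint S (S x) := fun x => by
    rw [hS]; rfl
  have hSv : S v ≠ 0 := fun hc => hv (by rw [hAS, hc, map_zero])
  set u : H := ((‖S v‖⁻¹ : ℝ) : ℂ) • S v with hu
  have hu1 : ‖u‖ = 1 := by
    rw [hu, norm_smul, Complex.norm_real, norm_inv, norm_norm,
      inv_mul_cancel₀ (norm_ne_zero_iff.2 hSv)]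
  set y := ContinuousLinearMap.adjoint S u with hy
  have hy0 : y ≠ 0 := by
    rw [hy, hu, map_smul, ← hAS]
    refine smul_ne_zero ?_ hv
    simpa using hSv
  obtain ⟨t, ht⟩ := h (ray y) (ray_nonneg y) (by
    rw [← sub_nonneg]
    refine nonneg_of_re_inner_nonneg (A.2.1.sub (ray y).2.1) fun x => ?_
    rw [sub_apply, inner_sub_right, inner_ray_apply, hAS,
      ContinuousLinearMap.adjoint_inner_right, inner_self_eq_norm_sq_to_K, hy,
      ContinuousLinearMap.adjoint_inner_left]
    have h1 := norm_inner_le_norm (𝕜 := ℂ) u (S x)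
    rw [hu1, one_mul] at h1
    have h2 := pow_le_pow_left₀ (norm_nonneg _) h1 2
    rw [Complex.sub_re, Complex.ofReal_re]
    have h3 : (((‖S x‖ : ℝ) : ℂ) ^ 2).re = ‖S x‖ ^ 2 := by norm_cast
    simp only [Complex.coe_algebraMap]
    rw [h3]
    linarith)
  have hc := congrArg (charge H) ht
  rw [charge_ray, map_smul, smul_eq_mul] at hc
  have hA0 := charge_nonneg hA
  have hpos : 0 < ‖y‖ ^ 2 := by positivity
  have ht0 : 0 < t := by
    by_contra! hcon
    nlinarith
  refine ⟨((Real.sqrt t⁻¹ : ℝ) : ℂ) • y, ?_⟩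
  rw [ray_smul, ht, Complex.norm_real, Real.norm_of_nonneg (Real.sqrt_nonneg _),
    Real.sq_sqrt (inv_nonneg.2 ht0.le), smul_smul, inv_mul_cancel₀ ht0.ne', one_smul]

variable {Φ : TraceClassSA H →ₗ[ℝ] TraceClassSA H}

lemma IsStochastic.exists_map_ray_eq (hΦ : IsStochastic Φ) (hs : Function.Surjective Φ)
    (hr : ReflectsPositivity Φ) (x : H) : ∃ y, Φ (ray x) = ray y := by
  refine exists_eq_ray_of_extremal (hΦ.positive _ (ray_nonneg x)) fun B hB hle => ?_
  obtain ⟨C, rfl⟩ := hs B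
  have h1 : (C : H →L[ℂ] H) ≤ (ray x : H →L[ℂ] H) := by
    rw [← sub_nonneg]
    exact hr (ray x - C) (by rw [map_sub]; exact sub_nonneg.2 hle)
  obtain ⟨t, rfl⟩ := exists_smul_ray_of_le (hr C hB) h1
  exact ⟨t, map_smul Φ t _⟩

lemma IsStochastic.norm_eq_of_map_ray_eq (hΦ : IsStochastic Φ) {x y : H}
    (h : Φ (ray x) = ray y) : ‖y‖ = ‖x‖ := by
  have h1 := hΦ.charge_preserving (ray x)
  rw [h, charge_ray, charge_ray] at h1
  exact (pow_left_inj₀ (norm_nonneg _) (norm_nonneg _) two_ne_zero).1 h1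

/-! ### The image of the orthogonal complement of a unit vector -/

omit [CompleteSpace H] in
lemma exists_inner_eq_zero_and_inner_eq_one {a v : H} (h : ⟪v, v⟫_ℂ • a ≠ ⟪v, a⟫_ℂ • v) :
    ∃ w, ⟪v, w⟫_ℂ = 0 ∧ ⟪a, w⟫_ℂ = 1 := by
  set w := ⟪v, v⟫_ℂ • a - ⟪v, a⟫_ℂ • v with hw
  have hvw : ⟪v, w⟫_ℂ = 0 := by
    rw [hw, inner_sub_right, inner_smul_right, inner_smul_right]; ring
  have haw : ⟪a, w⟫_ℂ ≠ 0 := by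
    intro h0
    apply sub_ne_zero.2 h
    rw [← hw, ← inner_self_eq_zero (𝕜 := ℂ)]
    nth_rewrite 1 [hw]
    rw [inner_sub_left, inner_smul_left, inner_smul_left, h0, hvw]
    ring
  refine ⟨(⟪a, w⟫_ℂ)⁻¹ • w, ?_, ?_⟩
  · rw [inner_smul_right, hvw, mul_zero]
  · rw [inner_smul_right, inv_mul_cancel₀ haw]

/-- For `y ⟂ e` the operators `Φ (ray (e + t • y))`, with `t` real, form a quadratic curve of
rank-one operators. Evaluating it at a vector dual to `e'` exhibits it as `ray (e' + t • u)`. -/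
lemma IsStochastic.exists_map_cross_eq (hΦ : IsStochastic Φ) (hs : Function.Surjective Φ)
    (hr : ReflectsPositivity Φ) {e e' y : H} (he : ‖e‖ = 1) (hee' : Φ (ray e) = ray e')
    (hy : ⟪e, y⟫_ℂ = 0) :
    ∃ u, Φ (cross e y) = cross e' u ∧ Φ (ray y) = ray u ∧ (⟪e', u⟫_ℂ).re = 0 := by
  suffices h : ∃ u, Φ (cross e y) = cross e' u ∧ Φ (ray y) = ray u by
    obtain ⟨u, h1, h2⟩ := h
    refine ⟨u, h1, h2, ?_⟩
    have h3 := hΦ.charge_preserving (cross e y)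
    rw [h1, charge_cross, charge_cross, hy, Complex.zero_re, mul_zero] at h3
    linarith
  by_cases hy0 : y = 0
  · exact ⟨0, by simp [hy0], by simp [hy0, ray_zero]⟩
  obtain ⟨v, hv⟩ := hΦ.exists_map_ray_eq hs hr y
  have hv0 : v ≠ 0 := by
    rw [← norm_ne_zero_iff, hΦ.norm_eq_of_map_ray_eq hv]
    exact norm_ne_zero_iff.2 hy0
  obtain ⟨h, hvh, heh⟩ := exists_inner_eq_zero_and_inner_eq_one (a := e') (v := v) (by
    -- otherwise `ray e` and `ray y` would be proportional
    intro hc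
    have h1 := congrArg ray hc
    rw [ray_smul, ray_smul, ← hee', ← hv, ← map_smul, ← map_smul] at h1
    have h2 := congrArg (fun z : TraceClassSA H => (z : H →L[ℂ] H) e) (hr.injective h1)
    have h3 : ⟪y, e⟫_ℂ = 0 := by rw [← inner_conj_symm, hy, map_zero]
    simp only [Submodule.coe_smul, smul_apply, ray_apply, h3, zero_smul, smul_zero,
      inner_self_eq_norm_sq_to_K, he] at h2
    have he0 : e ≠ 0 := by rw [← norm_ne_zero_iff, he]; exact one_ne_zero
    simp [he0, hv0] at h2)
  have hhe : ⟪h, e'⟫_ℂ = 1 := by rw [← inner_conj_symm, heh, map_one]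
  set S := Φ (cross e y) with hS
  set u := (S : H →L[ℂ] H) h with hu
  have hexp : ∀ t : ℝ, Φ (ray (e + t • y)) = ray e' + t • S + (t ^ 2) • ray v := by
    intro t
    rw [ray_add, map_smul, ← Complex.coe_smul, ray_smul, Complex.norm_real, Real.norm_eq_abs,
      sq_abs, map_add, map_add, map_smul, map_smul, hv, hee']
  have happ : ∀ (t : ℝ) (w : H), Φ (ray (e + t • y)) = ray w →
      ⟪w, h⟫_ℂ • w = e' + t • u := by
    intro t w hw
    rw [← ray_apply, ← hw, hexp]
    simp [ray_apply, heh, hvh, hu]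
  have hnorm : ∀ (t : ℝ) (w : H), Φ (ray (e + t • y)) = ray w →
      ‖⟪w, h⟫_ℂ‖ ^ 2 = 1 + t * (⟪h, u⟫_ℂ).re := by
    intro t w hw
    have h1 := congrArg (fun x => (⟪h, x⟫_ℂ).re) (happ t w hw)
    simp only [← ray_apply] at h1
    rw [inner_ray_apply, Complex.ofReal_re, inner_add_right, hhe, ← Complex.coe_smul,
      inner_smul_right, Complex.add_re, Complex.one_re, Complex.re_ofReal_mul] at h1
    exact h1
  have hhu : (⟪h, u⟫_ℂ).re = 0 := by
    by_contra hne
    obtain ⟨w, hw⟩ := hΦ.exists_map_ray_eq hs hr (e + (-2 / (⟪h, u⟫_ℂ).re : ℝ) • y)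
    have h1 := hnorm _ w hw
    rw [div_mul_cancel₀ _ hne] at h1
    have : 0 ≤ ‖⟪w, h⟫_ℂ‖ ^ 2 := by positivity
    linarith
  have hcurve : ∀ t : ℝ, t • S + (t ^ 2) • ray v = t • cross e' u + (t ^ 2) • ray u := by
    intro t
    obtain ⟨w, hw⟩ := hΦ.exists_map_ray_eq hs hr (e + t • y)
    have h1 : ray w = ray (e' + t • u) := by
      rw [← happ t w hw, ray_smul, hnorm t w hw, hhu, mul_zero, add_zero, one_smul]
    rw [← hw, hexp, ray_add, map_smul, ← Complex.coe_smul t u, ray_smul, Complex.norm_real,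
      Real.norm_eq_abs, sq_abs, add_assoc, add_assoc] at h1
    exact add_left_cancel h1
  have hp := hcurve 1
  have hm := hcurve (-1)
  simp only [one_smul, one_pow, even_two.neg_pow] at hp hm
  refine ⟨u, ?_, ?_⟩
  · calc S = (1 / 2 : ℝ) • (S + ray v - ((-1 : ℝ) • S + ray v)) := by module
      _ = (1 / 2 : ℝ) • (cross e' u + ray u - ((-1 : ℝ) • cross e' u + ray u)) := by rw [hp, hm]
      _ = cross e' u := by module
  · calc Φ (ray y) = (1 / 2 : ℝ) • (S + ray v + ((-1 : ℝ) • S + ray v)) := by rw [hv]; module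
      _ = (1 / 2 : ℝ) • (cross e' u + ray u + ((-1 : ℝ) • cross e' u + ray u)) := by rw [hp, hm]
      _ = ray u := by module

/-- The real-linear map `y ↦ Φ (|e⟩⟨y| + |y⟩⟨e|) e'`. It represents `Φ` on the orthogonal
complement of the unit vector `e` when `Φ |e⟩⟨e| = |e'⟩⟨e'|`. -/
noncomputable def crossMap (Φ : TraceClassSA H →ₗ[ℝ] TraceClassSA H) (e e' : H) : H →ₗ[ℝ] H where
  toFun y := (Φ (cross e y) : H →L[ℂ] H) e'
  map_add' y z := by simp
  map_smul' r y := by simp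

lemma IsStochastic.crossMap_spec (hΦ : IsStochastic Φ) (hs : Function.Surjective Φ)
    (hr : ReflectsPositivity Φ) {e e' y : H} (he : ‖e‖ = 1) (hee' : Φ (ray e) = ray e')
    (hy : ⟪e, y⟫_ℂ = 0) :
    Φ (cross e y) = cross e' (crossMap Φ e e' y) ∧ Φ (ray y) = ray (crossMap Φ e e' y) := by
  obtain ⟨u, h1, h2, h3⟩ := hΦ.exists_map_cross_eq hs hr he hee' hy
  suffices hu : ⟪e', u⟫_ℂ = 0 by
    have : crossMap Φ e e' y = u := by
      change (Φ (cross e y) : H →L[ℂ] H) e' = u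
      have hue : ⟪u, e'⟫_ℂ = 0 := by rw [← inner_conj_symm, hu, map_zero]
      have he' : ‖e'‖ = 1 := (hΦ.norm_eq_of_map_ray_eq hee').trans he
      rw [h1, cross_apply, hue, inner_self_eq_norm_sq_to_K, he']
      simp
    rw [this]
    exact ⟨h1, h2⟩
  have hy' : ⟪e, Complex.I • y⟫_ℂ = 0 := by rw [inner_smul_right, hy, mul_zero]
  -- `u` and the vector `u'` that belongs to `I • y` differ by a phase `k`
  obtain ⟨u', h1', h2', h3'⟩ := hΦ.exists_map_cross_eq hs hr he hee' hy'
  obtain ⟨k, hk, rfl⟩ := exists_phase_of_ray_eq (x := u) (y := u') (by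
    rw [← h2, ← h2', ray_smul, Complex.norm_I, one_pow, one_smul])
  by_cases hk0 : k.im = 0
  -- a real `k` contradicts injectivity of `Φ`, unless `y = 0`
  · have hkr : k = (k.re : ℂ) := Complex.ext (by simp) (by simp [hk0])
    rw [hkr, Complex.coe_smul, map_smul (cross e') k.re u, ← h1, ← map_smul Φ,
      ← map_smul (cross e)] at h1'
    have h4 := congrArg (fun z : TraceClassSA H => (z : H →L[ℂ] H) e) (hr.injective h1')
    have hye : ⟪y, e⟫_ℂ = 0 := by rw [← inner_conj_symm, hy, map_zero]
    rw [← Complex.coe_smul] at h4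
    simp only [cross_apply, inner_smul_left, hye, mul_zero, zero_smul, zero_add,
      inner_self_eq_norm_sq_to_K, he] at h4
    have h5 : (Complex.I - (k.re : ℂ)) • y = 0 := by
      rw [sub_smul, sub_eq_zero]
      simpa using h4
    rcases smul_eq_zero.1 h5 with h6 | h6
    · have := congrArg Complex.im h6
      simp at this
    · have := hΦ.norm_eq_of_map_ray_eq h2
      rw [h6, norm_zero, norm_eq_zero] at this
      rw [this, inner_zero_right]
  -- otherwise `⟪e', u⟫` and `k * ⟪e', u⟫` are both purely imaginary
  · rw [inner_smul_right, Complex.mul_re, h3, mul_zero, zero_sub, neg_eq_zero, mul_eq_zero] at h3'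
    exact Complex.ext h3 (h3'.resolve_left hk0)

lemma IsStochastic.norm_crossMap (hΦ : IsStochastic Φ) (hs : Function.Surjective Φ)
    (hr : ReflectsPositivity Φ) {e e' y : H} (he : ‖e‖ = 1) (hee' : Φ (ray e) = ray e')
    (hy : ⟪e, y⟫_ℂ = 0) : ‖crossMap Φ e e' y‖ = ‖y‖ :=
  hΦ.norm_eq_of_map_ray_eq (hΦ.crossMap_spec hs hr he hee' hy).2

lemma IsStochastic.crossMap_I_smul (hΦ : IsStochastic Φ) (hs : Function.Surjective Φ)
    (hr : ReflectsPositivity Φ) {e e' y : H} (he : ‖e‖ = 1) (hee' : Φ (ray e) = ray e')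
    (hy : ⟪e, y⟫_ℂ = 0) :
    crossMap Φ e e' (Complex.I • y) = Complex.I • crossMap Φ e e' y ∨
      crossMap Φ e e' (Complex.I • y) = -Complex.I • crossMap Φ e e' y := by
  by_cases hy0 : y = 0
  · simp [hy0]
  have hy' : ⟪e, Complex.I • y⟫_ℂ = 0 := by rw [inner_smul_right, hy, mul_zero]
  obtain ⟨k, hk, hk'⟩ := exists_phase_of_ray_eq (x := crossMap Φ e e' y)
    (y := crossMap Φ e e' (Complex.I • y)) (by
      rw [← (hΦ.crossMap_spec hs hr he hee' hy).2, ← (hΦ.crossMap_spec hs hr he hee' hy').2,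
        ray_smul, Complex.norm_I, one_pow, one_smul])
  -- comparing the norms of `(I + 1) • y` and its image gives `‖k + 1‖ = ‖I + 1‖`
  have hsum := hΦ.norm_crossMap hs hr (y := Complex.I • y + y) he hee' (by
    rw [inner_add_right, hy, hy', add_zero])
  have e1 : Complex.I • y + y = (Complex.I + 1) • y := by rw [add_smul, one_smul]
  have e2 : k • crossMap Φ e e' y + crossMap Φ e e' y = (k + 1) • crossMap Φ e e' y := by
    rw [add_smul, one_smul]
  rw [map_add, hk', e2, e1, norm_smul, norm_smul, hΦ.norm_crossMap hs hr he hee' hy] at hsum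
  have h1 := mul_right_cancel₀ (norm_ne_zero_iff.2 hy0) hsum
  have h2 : k.re * k.re + k.im * k.im = 1 := by
    rw [← Complex.normSq_apply, Complex.normSq_eq_norm_sq, hk, one_pow]
  have h3 : (k.re + 1) * (k.re + 1) + k.im * k.im = 2 := by
    have := congrArg (fun r : ℝ => r ^ 2) h1
    simp only [← Complex.normSq_eq_norm_sq, Complex.normSq_apply] at this
    simp at this
    linarith
  have h4 : k.re = 0 := by linarith
  have h5 : k.im = 1 ∨ k.im = -1 := by
    rw [h4] at h2
    exact mul_self_eq_one_iff.1 (by linarith)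
  rw [hk']
  rcases h5 with h5 | h5
  · left; congr 1; exact Complex.ext (by simp [h4]) (by simp [h5])
  · right; congr 1; exact Complex.ext (by simp [h4]) (by simp [h5])

/-- The sign in `crossMap_I_smul` does not depend on the vector, by additivity. -/
lemma IsStochastic.crossMap_I_smul_uniform (hΦ : IsStochastic Φ) (hs : Function.Surjective Φ)
    (hr : ReflectsPositivity Φ) {e e' : H} (he : ‖e‖ = 1) (hee' : Φ (ray e) = ray e') :
    (∀ y, ⟪e, y⟫_ℂ = 0 → crossMap Φ e e' (Complex.I • y) = Complex.I • crossMap Φ e e' y) ∨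
      ∀ y, ⟪e, y⟫_ℂ = 0 →
        crossMap Φ e e' (Complex.I • y) = -Complex.I • crossMap Φ e e' y := by
  by_contra! hcon
  obtain ⟨⟨y, hy, hy1⟩, z, hz, hz1⟩ := hcon
  have hy2 := (hΦ.crossMap_I_smul hs hr he hee' hy).resolve_left hy1
  have hz2 := (hΦ.crossMap_I_smul hs hr he hee' hz).resolve_right hz1
  rcases hΦ.crossMap_I_smul hs hr (y := y + z) he hee' (by rw [inner_add_right, hy, hz, add_zero])
    with h | h
  · rw [smul_add, map_add, map_add, smul_add, hz2] at h
    exact hy1 (add_right_cancel h)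
  · rw [smul_add, map_add, map_add, smul_add, hy2] at h
    exact hz1 (add_left_cancel h)

lemma crossMap_smul {e e' : H} {σ : ℂ →+* ℂ} (hσ : σ = RingHom.id ℂ ∨ σ = starRingEnd ℂ)
    (h : ∀ y, ⟪e, y⟫_ℂ = 0 → crossMap Φ e e' (Complex.I • y) = σ Complex.I • crossMap Φ e e' y)
    (a : ℂ) {y : H} (hy : ⟪e, y⟫_ℂ = 0) :
    crossMap Φ e e' (a • y) = σ a • crossMap Φ e e' y := by
  have h1 : a • y = a.re • y + a.im • Complex.I • y := by
    conv_lhs => rw [← Complex.re_add_im a]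
    rw [add_smul, mul_smul, Complex.coe_smul, Complex.coe_smul]
  have h2 : σ a = a.re + a.im * σ Complex.I := by
    rcases hσ with rfl | rfl
    · exact (Complex.re_add_im a).symm
    · exact Complex.ext (by simp) (by simp)
  rw [h1, map_add, map_smul, map_smul, h y hy, h2, add_smul, mul_smul, Complex.coe_smul,
    Complex.coe_smul]

/-! ### Wigner's theorem for stochastic maps -/

/-- The rank-one operators are mapped as by a linear or antilinear isometry `W`. On a unit vector
`e` and its orthogonal complement, `W` is given by a representative of `Φ |e⟩⟨e|` and by
`crossMap`. -/
lemma IsStochastic.exists_isometry_map_ray [Nontrivial H] (hΦ : IsStochastic Φ)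
    (hs : Function.Surjective Φ) (hr : ReflectsPositivity Φ) :
    ∃ σ : ℂ →+* ℂ, (σ = RingHom.id ℂ ∨ σ = starRingEnd ℂ) ∧
      ∃ W : H →ₛₗᵢ[σ] H, ∀ x, Φ (ray x) = ray (W x) := by
  obtain ⟨e, he⟩ := exists_norm_eq H zero_le_one
  obtain ⟨e', hee'⟩ := hΦ.exists_map_ray_eq hs hr e
  have hσ : ∃ σ : ℂ →+* ℂ, (σ = RingHom.id ℂ ∨ σ = starRingEnd ℂ) ∧ ∀ y, ⟪e, y⟫_ℂ = 0 →
      crossMap Φ e e' (Complex.I • y) = σ Complex.I • crossMap Φ e e' y := by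
    rcases hΦ.crossMap_I_smul_uniform hs hr he hee' with h | h
    · exact ⟨RingHom.id ℂ, Or.inl rfl, h⟩
    · exact ⟨starRingEnd ℂ, Or.inr rfl, by simpa only [Complex.conj_I] using h⟩
  obtain ⟨σ, hσ, hI⟩ := hσ
  have hperp : ∀ x, ⟪e, x - ⟪e, x⟫_ℂ • e⟫_ℂ = 0 := fun x => by
    rw [inner_sub_right, inner_smul_right, inner_self_eq_norm_sq_to_K, he]
    simp
  let W : H →ₛₗ[σ] H :=
    { toFun := fun x => σ ⟪e, x⟫_ℂ • e' + crossMap Φ e e' (x - ⟪e, x⟫_ℂ • e)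
      map_add' := fun x y => by
        have : x + y - ⟪e, x + y⟫_ℂ • e = (x - ⟪e, x⟫_ℂ • e) + (y - ⟪e, y⟫_ℂ • e) := by
          rw [inner_add_right, add_smul]; abel
        rw [this, map_add, inner_add_right, map_add, add_smul]
        abel
      map_smul' := fun a x => by
        have : a • x - ⟪e, a • x⟫_ℂ • e = a • (x - ⟪e, x⟫_ℂ • e) := by
          rw [inner_smul_right, smul_sub, mul_smul]
        rw [this, crossMap_smul hσ hI a (hperp x), inner_smul_right, map_mul, mul_smul, smul_add] }
  have hW : ∀ x, Φ (ray x) = ray (W x) := by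
    intro x
    change _ = ray (σ ⟪e, x⟫_ℂ • e' + crossMap Φ e e' (x - ⟪e, x⟫_ℂ • e))
    set p := x - ⟪e, x⟫_ℂ • e with hp
    set a := ⟪e, x⟫_ℂ with ha
    have hx : x = a • e + p := by rw [hp]; abel
    have hep : ⟪e, p⟫_ℂ = 0 := hperp x
    have hep' : ⟪e, (starRingEnd ℂ a) • p⟫_ℂ = 0 := by rw [inner_smul_right, hep, mul_zero]
    have hn : ‖σ a‖ = ‖a‖ := by rcases hσ with rfl | rfl <;> simp
    have hc : σ (starRingEnd ℂ a) = starRingEnd ℂ (σ a) := by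
      rcases hσ with rfl | rfl <;> simp
    rw [hx, ray_add, ray_add, cross_smul_left, cross_smul_left, map_add, map_add, ray_smul,
      ray_smul, map_smul, hee', hn, (hΦ.crossMap_spec hs hr he hee' hep).2,
      (hΦ.crossMap_spec hs hr he hee' hep').1, crossMap_smul hσ hI _ hep, hc]
  exact ⟨σ, hσ, ⟨W, fun x => hΦ.norm_eq_of_map_ray_eq (hW x)⟩, hW⟩

/-! ### Trace-norm approximation by rank-one operators -/

lemma norm_apply_le_charge {z : TraceClassSA H} (hz : 0 ≤ (z : H →L[ℂ] H)) (x : H) :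
    ‖(z : H →L[ℂ] H) x‖ ≤ charge H z * ‖x‖ := by
  obtain ⟨S, hS⟩ := CStarAlgebra.nonneg_iff_eq_star_mul_self.1 hz
  have hc := charge_nonneg hz
  have hSn : ‖S‖ ≤ √(charge H z) := by
    refine S.opNorm_le_bound (Real.sqrt_nonneg _) fun y => ?_
    rw [← abs_of_nonneg (norm_nonneg (S y)),
      ← abs_of_nonneg (mul_nonneg (Real.sqrt_nonneg _) (norm_nonneg y)), ← sq_le_sq, mul_pow,
      Real.sq_sqrt hc]
    refine le_trans (le_of_eq ?_) (re_inner_le_charge hz y)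
    rw [hS, mul_apply_eq_comp, ContinuousLinearMap.star_eq_adjoint,
      ContinuousLinearMap.adjoint_inner_right, inner_self_eq_norm_sq_to_K]
    norm_cast
  calc ‖(z : H →L[ℂ] H) x‖ ≤ ‖(z : H →L[ℂ] H)‖ * ‖x‖ := ContinuousLinearMap.le_opNorm _ _
    _ ≤ _ := by
      gcongr
      rw [hS, CStarRing.norm_star_mul_self, ← Real.mul_self_sqrt hc]
      gcongr

/-- A positive `z = S* S` of trace class is the sum of the operators `|S* bᵢ⟩⟨S* bᵢ|` for an
orthonormal basis `b`, strongly and in trace. -/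
lemma exists_hasSum_ray {z : TraceClassSA H} (hz : 0 ≤ (z : H →L[ℂ] H)) :
    ∃ v : basisIndex H → H,
      (∀ x, HasSum (fun i => (ray (v i) : H →L[ℂ] H) x) ((z : H →L[ℂ] H) x)) ∧
      HasSum (fun i => charge H (ray (v i))) (charge H z) := by
  obtain ⟨S, hS⟩ := CStarAlgebra.nonneg_iff_eq_star_mul_self.1 hz
  refine ⟨fun i => star S (basis H i), fun x => ?_, ?_⟩
  · have h := ((basis H).hasSum_repr (S x)).mapL (star S)
    rw [hS, mul_apply_eq_comp]
    convert h using 2 with i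
    rw [ray_apply, map_smul, HilbertBasis.repr_apply_apply, ContinuousLinearMap.star_eq_adjoint,
      ContinuousLinearMap.adjoint_inner_left]
  · have h : diagSum (basis H) (z : H →L[ℂ] H) =
        ∑' i, ENNReal.ofReal (‖star S (basis H i)‖ ^ 2) := by
      rw [hS, diagSum_star_mul, hs_adjoint (basis H) (basis H)]
    have hne := diagSum_ne_top hz
    rw [charge_eq_traceNorm hz, traceNorm_eq_toReal_diagSum hz]
    rw [h] at hne ⊢
    rw [ENNReal.tsum_toReal_eq fun _ => ENNReal.ofReal_ne_top]
    convert (ENNReal.summable_toReal hne).hasSum using 2 with i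
    rw [charge_ray, ENNReal.toReal_ofReal (by positivity)]

/-- Stochastic maps preserve the decomposition of `exists_hasSum_ray`: the remainders are positive
and their traces tend to zero. -/
lemma IsStochastic.hasSum_map_ray (hΦ : IsStochastic Φ) {z : TraceClassSA H} {ι : Type*}
    {v : ι → H} (hv : ∀ x, HasSum (fun i => (ray (v i) : H →L[ℂ] H) x) ((z : H →L[ℂ] H) x))
    (hc : HasSum (fun i => charge H (ray (v i))) (charge H z)) (x : H) :
    HasSum (fun i => (Φ (ray (v i)) : H →L[ℂ] H) x) ((Φ z : H →L[ℂ] H) x) := by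
  have hpos : ∀ F : Finset ι, 0 ≤ ((z - ∑ i ∈ F, ray (v i) : TraceClassSA H) : H →L[ℂ] H) := by
    intro F
    refine nonneg_of_re_inner_nonneg (z - ∑ i ∈ F, ray (v i)).2.1 fun y => ?_
    have h1 : HasSum (fun i => (⟪y, (ray (v i) : H →L[ℂ] H) y⟫_ℂ).re)
        (⟪y, (z : H →L[ℂ] H) y⟫_ℂ).re :=
      ((hv y).mapL (innerSL ℂ y)).mapL Complex.reCLM
    have h2 := sum_le_hasSum F (fun i _ => re_nonneg (ray_nonneg (v i)) y) h1
    simp only [Submodule.coe_sub, Submodule.coe_sum, sub_apply, sum_apply,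
      inner_sub_right, inner_sum, Complex.sub_re, Complex.re_sum]
    linarith
  have hlim : Filter.Tendsto (fun F : Finset ι => charge H (z - ∑ i ∈ F, ray (v i)) * ‖x‖)
      Filter.atTop (nhds 0) := by
    have h1 : Filter.Tendsto (fun F : Finset ι => charge H z - ∑ i ∈ F, charge H (ray (v i)))
        Filter.atTop (nhds (charge H z - charge H z)) := Filter.Tendsto.const_sub _ hc
    have h2 := h1.mul_const ‖x‖
    rw [sub_self, zero_mul] at h2
    simpa only [map_sub, map_sum] using h2
  rw [HasSum, SummationFilter.unconditional_filter, tendsto_iff_norm_sub_tendsto_zero]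
  refine squeeze_zero (fun _ => norm_nonneg _) (fun F => ?_) hlim
  have h := norm_apply_le_charge (hΦ.positive _ (hpos F)) x
  rw [hΦ.charge_preserving] at h
  refine le_trans (le_of_eq ?_) h
  rw [norm_sub_rev, map_sub, map_sum, Submodule.coe_sub, Submodule.coe_sum, sub_apply,
    sum_apply]

/-! ### Maps induced by a semilinear isometry

Linear and antilinear isometries are treated together, as isometries that are semilinear over
`σ = id` or `σ = conj`. The adjoint `V` of `W` is then determined by `σ ⟪v, V x⟫ = ⟪W v, x⟫`. -/

section Induced

variable {σ : ℂ →+* ℂ} {W : H →ₛₗᵢ[σ] H} {V : H → H}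

lemma IsStochastic.map_apply_eq (hΦ : IsStochastic Φ) (hW : ∀ x, Φ (ray x) = ray (W x))
    (hV : ∀ v x, σ ⟪v, V x⟫_ℂ = ⟪W v, x⟫_ℂ) (z : TraceClassSA H) (x : H) :
    (Φ z : H →L[ℂ] H) x = W ((z : H →L[ℂ] H) (V x)) := by
  have hpos : ∀ z : TraceClassSA H, 0 ≤ (z : H →L[ℂ] H) →
      (Φ z : H →L[ℂ] H) x = W ((z : H →L[ℂ] H) (V x)) := by
    intro z hz
    obtain ⟨v, hv, hc⟩ := exists_hasSum_ray hz
    have h : HasSum (fun i => W ((ray (v i) : H →L[ℂ] H) (V x))) (W ((z : H →L[ℂ] H) (V x))) :=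
      (hv (V x)).map W.toLinearMap.toAddMonoidHom W.continuous
    refine (hΦ.hasSum_map_ray hv hc x).unique ?_
    convert h using 2 with i
    rw [hW, ray_apply, ray_apply, W.map_smulₛₗ, hV]
  rw [← posPart_sub_negPart z, map_sub, Submodule.coe_sub, Submodule.coe_sub, sub_apply, sub_apply,
    map_sub, hpos _ (posPart_nonneg z), hpos _ (negPart_nonneg z)]

omit [CompleteSpace H] in
lemma inner_map_map_of_semilinear (hσ : σ = RingHom.id ℂ ∨ σ = starRingEnd ℂ) (W : H →ₛₗᵢ[σ] H)
    (x y : H) : ⟪W x, W y⟫_ℂ = σ ⟪x, y⟫_ℂ := by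
  have hre : ∀ y, (⟪W x, W y⟫_ℂ).re = (⟪x, y⟫_ℂ).re := by
    intro y
    have h := congrArg (fun r : ℝ => r ^ 2) (W.norm_map (x + y))
    simp only [map_add, norm_add_sq (𝕜 := ℂ), W.norm_map] at h
    simp only [RCLike.re_to_complex] at h
    linarith
  have him := hre (Complex.I • y)
  rw [W.map_smulₛₗ, inner_smul_right, inner_smul_right] at him
  rcases hσ with rfl | rfl
  · exact Complex.ext (hre y) (by simpa only [RingHom.id_apply, Complex.I_mul_re, neg_inj] using him)
  · refine Complex.ext (by rw [hre y, Complex.conj_re]) ?_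
    simp at him
    rw [Complex.conj_im]
    linarith

lemma reflectsPositivity_of_induced (hσ : σ = RingHom.id ℂ ∨ σ = starRingEnd ℂ)
    (hV : ∀ v x, σ ⟪v, V x⟫_ℂ = ⟪W v, x⟫_ℂ)
    (h : ∀ (z : TraceClassSA H) (x : H), (Φ z : H →L[ℂ] H) x = W ((z : H →L[ℂ] H) (V x))) :
    ReflectsPositivity Φ := by
  have hVW : ∀ w, V (W w) = w := fun w => by
    refine ext_inner_left ℂ fun v => σ.injective ?_
    rw [hV, inner_map_map_of_semilinear hσ]
  intro z hz
  refine nonneg_of_re_inner_nonneg z.2.1 fun x => ?_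
  have h1 := re_nonneg hz (W x)
  rw [h, hVW, inner_map_map_of_semilinear hσ] at h1
  rcases hσ with rfl | rfl
  · exact h1
  · rwa [Complex.conj_re] at h1

lemma surjective_of_induced (hσ : σ = RingHom.id ℂ ∨ σ = starRingEnd ℂ)
    (hs : Function.Surjective Φ)
    (h : ∀ (z : TraceClassSA H) (x : H), (Φ z : H →L[ℂ] H) x = W ((z : H →L[ℂ] H) (V x))) :
    Function.Surjective W := by
  intro y
  by_cases hy : y = 0
  · exact ⟨0, by rw [hy, map_zero]⟩
  obtain ⟨z, hz⟩ := hs (ray y)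
  have h1 := h z y
  rw [hz, ray_apply] at h1
  refine ⟨σ (⟪y, y⟫_ℂ)⁻¹ • (z : H →L[ℂ] H) (V y), ?_⟩
  have hσσ : ∀ a, σ (σ a) = a := by
    intro a; rcases hσ with rfl | rfl <;> simp
  rw [W.map_smulₛₗ, hσσ, ← h1, smul_smul, inv_mul_cancel₀ (inner_self_ne_zero.2 hy), one_smul]

end Induced

lemma inner_adjoint_linearIsometry (U : H →ₗᵢ[ℂ] H) (v x : H) :
    RingHom.id ℂ ⟪v, ContinuousLinearMap.adjoint U.toContinuousLinearMap x⟫_ℂ = ⟪U v, x⟫_ℂ := by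
  rw [RingHom.id_apply, ContinuousLinearMap.adjoint_inner_right]
  rfl

lemma conj_inner_antiAdjoint (U : H →ₛₗᵢ[starRingEnd ℂ] H) (v x : H) :
    starRingEnd ℂ ⟪v, antiAdjoint U.toContinuousLinearMap x⟫_ℂ = ⟪U v, x⟫_ℂ := by
  rw [inner_conj_symm, inner_antiAdjoint]
  rfl

lemma IsStochastic.isTraceNormIsometry_iff (hΦ : IsStochastic Φ) (hs : Function.Surjective Φ) :
    IsTraceNormIsometry Φ ↔
      (∃ U : H →ₗᵢ[ℂ] H, InducedByLinear Φ U.toContinuousLinearMap) ∨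
      (∃ U : H →ₛₗᵢ[starRingEnd ℂ] H, InducedByAntilinear Φ U.toContinuousLinearMap) := by
  constructor
  · intro h
    rcases subsingleton_or_nontrivial H with hH | hH
    · exact Or.inl ⟨LinearIsometry.id, fun z x => Subsingleton.elim _ _⟩
    obtain ⟨σ, rfl | rfl, W, hW⟩ := hΦ.exists_isometry_map_ray hs (hΦ.reflectsPositivity h)
    · exact Or.inl ⟨W, hΦ.map_apply_eq hW (inner_adjoint_linearIsometry W)⟩
    · exact Or.inr ⟨W, hΦ.map_apply_eq hW (conj_inner_antiAdjoint W)⟩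
  · rintro (⟨U, hU⟩ | ⟨U, hU⟩)
    · exact hΦ.isTraceNormIsometry hs
        (reflectsPositivity_of_induced (Or.inl rfl) (inner_adjoint_linearIsometry U) hU)
    · exact hΦ.isTraceNormIsometry hs
        (reflectsPositivity_of_induced (Or.inr rfl) (conj_inner_antiAdjoint U) hU)

end QuantumMC

theorem mainTheorem5 {H : Type*} [NormedAddCommGroup H] [InnerProductSpace ℂ H] [CompleteSpace H]
    [TopologicalSpace.SeparableSpace H]
    (Φ : QuantumMC.TraceClassSA H →ₗ[ℝ] QuantumMC.TraceClassSA H)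
    (hΦ : QuantumMC.IsStochastic Φ) (hsurj : Function.Surjective Φ) :
    (QuantumMC.IsTraceNormIsometry Φ ↔
      (∃ U : H →ₗᵢ[ℂ] H, QuantumMC.InducedByLinear Φ U.toContinuousLinearMap) ∨
      (∃ U : H →ₛₗᵢ[starRingEnd ℂ] H,
        QuantumMC.InducedByAntilinear Φ U.toContinuousLinearMap)) ∧
    (QuantumMC.IsTraceNormIsometry Φ ↔
      (∃ U : H ≃ₗᵢ[ℂ] H,
        QuantumMC.InducedByLinear Φ U.toLinearIsometry.toContinuousLinearMap) ∨
      (∃ U : H ≃ₗᵢ⋆[ℂ] H,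
        QuantumMC.InducedByAntilinear Φ U.toLinearIsometry.toContinuousLinearMap)) := by
  have key := hΦ.isTraceNormIsometry_iff hsurj
  refine ⟨key, key.trans ⟨?_, ?_⟩⟩
  · rintro (⟨U, hU⟩ | ⟨U, hU⟩)
    · exact Or.inl ⟨LinearIsometryEquiv.ofSurjective U
        (QuantumMC.surjective_of_induced (Or.inl rfl) hsurj hU), hU⟩
    · exact Or.inr ⟨LinearIsometryEquiv.ofSurjective U
        (QuantumMC.surjective_of_induced (Or.inr rfl) hsurj hU), hU⟩
  · rintro (⟨U, hU⟩ | ⟨U, hU⟩)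
    · exact Or.inl ⟨U.toLinearIsometry, hU⟩
    · exact Or.inr ⟨U.toLinearIsometry, hU⟩
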